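/- There are absolute constants $c>0$ and $\varepsilon_0>0$ such that the following holds for all $0<\varepsilon<\varepsilon_0$ and all integers $n,m,M$ with $n\ge \varepsilon^{-2}$, $m\ge\varepsilon^{-2}$ and $M\ge 1$. An insertion-only stream consists of $m$ updates $(i_k,\Delta_k)\in\{1,\dots,n\}\times\{0,\dots,M\}$; its frequency vector is $X\in\mathbb{Z}_{\ge0}^n$ with $X_i=\sum_{k:\,i_k=i}\Delta_k$, and, for $X\ne0$, its empirical Shannon entropy is $H(X)=\sum_{i:\,X_i>0}p_i\log(1/p_i)$, where $p_i=X_i/\|X\|_1$ and $\log$ is the natural logarithm. A randomized streaming algorithm reads the updates one at a time and keeps a bit string as its memory between updates. The initial memory, the new memory after each update (given the old memory, the update and the number of updates already read) and the final estimate (given the final memory) are computed without resource restrictions, with free access to a source of randomness (an arbitrary probability space; in particular, random oracles are allowed). Its space on streams of $m$ updates is the largest number of bits its memory ever has between updates (including before the first and after the last update), in the worst case over streams and randomness. If such an algorithm outputs, for every insertion-only stream of $m$ updates with frequency vector $X\neq 0$, an estimate $\tilde H$ with $|\tilde H-H(X)|\le\varepsilon$ with probability at least $2/3$, then its space is at least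 $c\,\varepsilon^{-2}$ bits. That is, $\varepsilon$-additive approximation of the empirical entropy in the insertion-only model with success probability $2/3$ requires $\Omega(\varepsilon^{-2})$ bits of space. -/

import Mathlib

/-- An update `(i, Δ)` of an insertion-only stream over the universe `[n]`:
a coordinate `i` and an increment `Δ ∈ {0, …, M}`. -/
abbrev StreamUpdate (n M : ℕ) : Type := Fin n × Fin (M + 1)

/-- The frequency vector `X ∈ ℕⁿ` of a stream: it starts at zero, and the update `(i, Δ)`
performs `X i ← X i + Δ`. -/
def frequencyVector {n M : ℕ} (σ : List (StreamUpdate n M)) : Fin n → ℕ :=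
  σ.foldl (fun X u => Function.update X u.1 (X u.1 + (u.2 : ℕ))) 0

/-- The empirical Shannon entropy (natural logarithm) `∑ i, pᵢ log (1 / pᵢ)`, `pᵢ = Xᵢ / ‖X‖₁`,
of a frequency vector. Coordinates with `Xᵢ = 0` contribute `0`. It is only used for `X ≠ 0`. -/
noncomputable def empiricalEntropy {n : ℕ} (X : Fin n → ℕ) : ℝ :=
  ∑ i, ((X i : ℝ) / ∑ j, (X j : ℝ)) * Real.log ((∑ j, (X j : ℝ)) / (X i : ℝ))

/-- A randomized streaming algorithm for insertion-only streams over `[n]` with increments at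
most `M`. Between two updates it keeps only a bit string, its memory. The sample point `ω : Ω`
is its source of randomness, which it can read at any time without paying for it (the random
oracle model). The processing of an update and the final output are arbitrary functions, of
unrestricted complexity, and may depend on the number of updates already read; in particular
the algorithm may use fresh random bits at every step. -/
structure StreamingAlgorithm (n M : ℕ) (Ω : Type*) [MeasurableSpace Ω] where
  /-- The initial memory. -/
  init : Ω → List Bool
  /-- `step k ω u s` is the memory after reading `u` as the `(k+1)`-st update in memory `s`. -/
  step : ℕ → Ω → StreamUpdate n M → List Bool → List Bool
  /-- The estimate that is returned at the end of the stream. -/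
  output : Ω → List Bool → ℝ
  measurableSet_init : ∀ s, MeasurableSet {ω | init ω = s}
  measurableSet_step : ∀ k u s s', MeasurableSet {ω | step k ω u s = s'}
  measurable_output : ∀ s, Measurable fun ω => output ω s

namespace StreamingAlgorithm

variable {n M : ℕ} {Ω : Type*} [MeasurableSpace Ω]

/-- The memory after reading the updates `σ`, when `k` updates have been read before and the
memory is then `s`. -/
def runFrom (A : StreamingAlgorithm n M Ω) (ω : Ω) :
    ℕ → List Bool → List (StreamUpdate n M) → List Bool
  | _, s, [] => s
  | k, s, u :: σ => A.runFrom ω (k + 1) (A.step k ω u s) σ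

/-- The memory after reading the updates `σ` from the start. -/
def run (A : StreamingAlgorithm n M Ω) (ω : Ω) (σ : List (StreamUpdate n M)) : List Bool :=
  A.runFrom ω 0 (A.init ω) σ

/-- On streams of `m` updates the algorithm uses at most `S` bits of space (in the worst case over
streams and randomness): at every time between updates, before the first and after the last one
included, its memory has at most `S` bits. -/
def UsesSpaceAtMost (A : StreamingAlgorithm n M Ω) (m S : ℕ) : Prop :=
  ∀ (ω : Ω) (σ : List (StreamUpdate n M)), σ.length ≤ m → (A.run ω σ).length ≤ S

/-- For every stream of `m` updates whose frequency vector is not zero, the output is, with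
probability at least `q`, within additive error `ε` of the empirical entropy of the frequency
vector at the end of the stream. -/
def ApproximatesEntropy (A : StreamingAlgorithm n M Ω) (P : MeasureTheory.Measure Ω)
    (m : ℕ) (ε q : ℝ) : Prop :=
  ∀ σ : List (StreamUpdate n M), σ.length = m → frequencyVector σ ≠ 0 →
    q ≤ P.real {ω | |A.output ω (A.run ω σ) - empiricalEntropy (frequencyVector σ)| ≤ ε}

end StreamingAlgorithm

/-! Reduction from one-way communication. Alice encodes a subset `x` of an `N`-element set by `N`
unit increments and Bob does the same with `y`; the empirical entropy of the combined stream is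
`log N + #(x ∆ y) * log 2 / N`, so an estimate with error `ε` determines `#(x ∆ y)` up to
an additive error less than `s / 2`, where `s` is of order `ε * N`, and the memory after the first
half of the stream is Alice's message. Both `1 / ε` and `s` are of order `√N`.

Fix the randomness so that the estimate is correct for two thirds of the pairs `(x, y)`. For a
constant fraction of the `x` it is then correct for more than three fifths of the `y`. If two such
sets `x`, `x'` lead to the same memory, then `|#(x ∆ y) - #(x' ∆ y)| < s` for more than a fifth of
the `y`. This difference is a sum of `#(x ∆ x')` independent random signs when `y` is uniform, so
by the Littlewood–Offord bound `#(x ∆ x')` is less than `25 * s ^ 2`. Hence each memory state serves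
only a Hamming ball of radius `k = 25 * s ^ 2`, and for `N = 10 * k` such a ball has at most
`3 ^ N / 2 ^ (N - k) ≤ 2 ^ (7 * k)` elements, which leaves at least a constant times
`2 ^ (3 * k)` states.
-/

open Finset MeasureTheory
open scoped symmDiff

theorem centralBinom_sq_mul_le (j : ℕ) : j.centralBinom ^ 2 * (2 * j + 1) ≤ 16 ^ j := by
  induction j with
  | zero => simp
  | succ j ih =>
    refine Nat.le_of_mul_le_mul_left ?_ (show 0 < (j + 1) ^ 2 by positivity)
    calc (j + 1) ^ 2 * ((j + 1).centralBinom ^ 2 * (2 * (j + 1) + 1))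
        = ((j + 1) * (j + 1).centralBinom) ^ 2 * (2 * j + 3) := by ring
      _ = j.centralBinom ^ 2 * (2 * j + 1) * (4 * ((2 * j + 1) * (2 * j + 3))) := by
          rw [Nat.succ_mul_centralBinom_succ]; ring
      _ ≤ 16 ^ j * (16 * (j + 1) ^ 2) := by gcongr ?_ * ?_; nlinarith
      _ = (j + 1) ^ 2 * 16 ^ (j + 1) := by ring

theorem centralBinom_succ_eq_two_mul_choose (j : ℕ) :
    (j + 1).centralBinom = 2 * (2 * j + 1).choose j := by
  rw [Nat.centralBinom_eq_two_mul_choose, show 2 * (j + 1) = 2 * j + 1 + 1 by ring,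
    Nat.choose_succ_succ', Nat.choose_symm_half, ← two_mul]

theorem choose_half_sq_mul_le (d : ℕ) : d.choose (d / 2) ^ 2 * d ≤ 4 ^ d := by
  obtain ⟨j, rfl | rfl⟩ := Nat.even_or_odd' d
  · calc (2 * j).choose (2 * j / 2) ^ 2 * (2 * j)
        ≤ j.centralBinom ^ 2 * (2 * j + 1) := by
          rw [Nat.centralBinom_eq_two_mul_choose, Nat.mul_div_cancel_left j two_pos]
          gcongr
          exact Nat.le_succ _
      _ ≤ 16 ^ j := centralBinom_sq_mul_le j
      _ = 4 ^ (2 * j) := by rw [pow_mul]; norm_num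
  · refine Nat.le_of_mul_le_mul_left ?_ (show 0 < 4 by norm_num)
    calc 4 * ((2 * j + 1).choose ((2 * j + 1) / 2) ^ 2 * (2 * j + 1))
        ≤ (j + 1).centralBinom ^ 2 * (2 * (j + 1) + 1) := by
          rw [centralBinom_succ_eq_two_mul_choose, show (2 * j + 1) / 2 = j by omega, mul_pow,
            mul_assoc]
          gcongr <;> omega
      _ ≤ 16 ^ (j + 1) := centralBinom_sq_mul_le (j + 1)
      _ = 4 * 4 ^ (2 * j + 1) := by
          rw [show 16 = 4 ^ 2 by norm_num, ← pow_mul, ← pow_succ']; ring_nf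

section Hamming

variable {α : Type*} [DecidableEq α]

theorem card_symmDiff_add_two_mul_card_inter (A B : Finset α) :
    #(A ∆ B) + 2 * #(B ∩ A) = #A + #B := by
  have hA := card_sdiff_add_card_inter A B
  have hB := card_sdiff_add_card_inter B A
  have hAB : #(A ∆ B) = #(A \ B) + #(B \ A) :=
    card_union_of_disjoint disjoint_sdiff_sdiff
  rw [inter_comm A B] at hA
  omega

theorem card_symmDiff_sub_card_symmDiff (A B Y : Finset α) :
    (#(B ∆ Y) : ℤ) - #(A ∆ Y) = #(A ∆ B) - 2 * #((A ∆ Y) ∩ (A ∆ B)) := by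
  have h := card_symmDiff_add_two_mul_card_inter (A ∆ B) (A ∆ Y)
  rw [symmDiff_comm A B, symmDiff_assoc, symmDiff_symmDiff_cancel_left, symmDiff_comm B A] at h
  omega

variable [Fintype α]

theorem card_filter_card_inter_eq_le (D : Finset α) (b : ℕ) :
    #{Z : Finset α | #(Z ∩ D) = b} ≤ (#D).choose b * 2 ^ (Fintype.card α - #D) := by
  rw [← card_powersetCard, ← card_compl, ← card_powerset, ← card_product]
  refine card_le_card_of_injOn (fun Z => (Z ∩ D, Z \ D)) (fun Z hZ => ?_) fun Z _ W _ hZW => ?_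
  · simpa [subset_iff] using hZ
  · obtain ⟨hinter, hsdiff⟩ := Prod.mk.inj hZW
    rw [← sdiff_union_inter Z D, ← sdiff_union_inter W D, hinter, hsdiff]

theorem sq_card_filter_abs_card_symmDiff_sub_lt_mul_le (A B : Finset α) (s : ℕ) :
    #{Y : Finset α | |(#(A ∆ Y) : ℤ) - #(B ∆ Y)| < s} ^ 2 * #(A ∆ B) ≤
      s ^ 2 * 4 ^ Fintype.card α := by
  set D := A ∆ B
  have hwindow : ∀ Y ∈ ({Y | |(#(A ∆ Y) : ℤ) - #(B ∆ Y)| < s} : Finset (Finset α)),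
      #((A ∆ Y) ∩ D) ∈ Ico ((#D + 1 - s) / 2) ((#D + 1 - s) / 2 + s) := by
    intro Y hY
    have hdiff : |(#D : ℤ) - 2 * #((A ∆ Y) ∩ D)| < s := by
      rwa [mem_filter_univ, abs_sub_comm, card_symmDiff_sub_card_symmDiff] at hY
    rw [abs_lt] at hdiff
    rw [mem_Ico]
    omega
  have hfiber : ∀ b, #{Y : Finset α | #((A ∆ Y) ∩ D) = b} ≤
      (#D).choose (#D / 2) * 2 ^ (Fintype.card α - #D) := by
    intro b
    calc #{Y : Finset α | #((A ∆ Y) ∩ D) = b}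
        ≤ #{Z : Finset α | #(Z ∩ D) = b} :=
          card_le_card_of_injOn (A ∆ ·) (fun Y hY => by simpa using hY)
            (symmDiff_right_injective A).injOn
      _ ≤ (#D).choose b * 2 ^ (Fintype.card α - #D) := card_filter_card_inter_eq_le D b
      _ ≤ _ := by gcongr; exact Nat.choose_le_middle b _
  have hcard := card_le_mul_card_image_of_maps_to hwindow _ fun b _ =>
    (card_le_card (filter_subset_filter _ (filter_subset _ _))).trans (hfiber b)
  rw [Nat.card_Ico, Nat.add_sub_cancel_left] at hcard
  calc #{Y : Finset α | |(#(A ∆ Y) : ℤ) - #(B ∆ Y)| < s} ^ 2 * #D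
      ≤ ((#D).choose (#D / 2) * 2 ^ (Fintype.card α - #D) * s) ^ 2 * #D := by gcongr
    _ = s ^ 2 * ((#D).choose (#D / 2) ^ 2 * #D * 4 ^ (Fintype.card α - #D)) := by
        rw [show 4 = 2 ^ 2 by norm_num, ← pow_mul]; ring
    _ ≤ s ^ 2 * (4 ^ #D * 4 ^ (Fintype.card α - #D)) := by
        gcongr
        exact choose_half_sq_mul_le _
    _ = s ^ 2 * 4 ^ Fintype.card α := by
        rw [← pow_add, Nat.add_sub_cancel' (card_le_univ D)]

theorem five_mul_card_filter_abs_card_symmDiff_sub_lt_le {A B : Finset α} {s : ℕ}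
    (hs : 25 * s ^ 2 ≤ #(A ∆ B)) :
    5 * #{Y : Finset α | |(#(A ∆ Y) : ℤ) - #(B ∆ Y)| < s} ≤ 2 ^ Fintype.card α := by
  obtain rfl | hs₀ := s.eq_zero_or_pos
  · simp [(abs_nonneg _).not_gt]
  have hpos : 0 < #(A ∆ B) := hs.trans_lt' (by positivity)
  refine (Nat.pow_le_pow_iff_left two_ne_zero).1 (Nat.le_of_mul_le_mul_right ?_ hpos)
  calc (5 * #{Y : Finset α | |(#(A ∆ Y) : ℤ) - #(B ∆ Y)| < s}) ^ 2 * #(A ∆ B)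
      = 25 * (#{Y : Finset α | |(#(A ∆ Y) : ℤ) - #(B ∆ Y)| < s} ^ 2 * #(A ∆ B)) := by ring
    _ ≤ 25 * (s ^ 2 * 4 ^ Fintype.card α) :=
        Nat.mul_le_mul_left 25 (sq_card_filter_abs_card_symmDiff_sub_lt_mul_le A B s)
    _ = 25 * s ^ 2 * (2 ^ Fintype.card α) ^ 2 := by
        rw [show 4 = 2 ^ 2 by norm_num, ← pow_mul, ← pow_mul, mul_comm 2]; ring
    _ ≤ #(A ∆ B) * (2 ^ Fintype.card α) ^ 2 := by gcongr
    _ = (2 ^ Fintype.card α) ^ 2 * #(A ∆ B) := mul_comm _ _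

theorem card_filter_card_symmDiff_le_mul_pow_le (A : Finset α) (k : ℕ) {b : ℕ} (hb : 0 < b) :
    #{B : Finset α | #(A ∆ B) ≤ k} * b ^ (Fintype.card α - k) ≤ (1 + b) ^ Fintype.card α := by
  calc #{B : Finset α | #(A ∆ B) ≤ k} * b ^ (Fintype.card α - k)
      ≤ ∑ B : Finset α with #(A ∆ B) ≤ k, b ^ (Fintype.card α - #(A ∆ B)) := by
        rw [← smul_eq_mul]
        refine card_nsmul_le_sum _ _ _ fun B hB => ?_
        exact Nat.pow_le_pow_right hb (Nat.sub_le_sub_left ((mem_filter_univ B).1 hB) _)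
    _ ≤ ∑ B : Finset α, b ^ (Fintype.card α - #(A ∆ B)) :=
        sum_le_sum_of_subset (filter_subset _ _)
    _ = ∑ D : Finset α, 1 ^ #D * b ^ (Fintype.card α - #D) := by
        simp only [one_pow, one_mul]
        exact (symmDiff_right_involutive A).bijective.sum_comp
          fun D => b ^ (Fintype.card α - #D)
    _ = (1 + b) ^ Fintype.card α := Fintype.sum_pow_mul_eq_add_pow α 1 b

end Hamming

section OneWay

variable {X Y ι : Type*} [Fintype X] [Fintype Y] [DecidableEq ι]

theorem sum_le_card_mul_add_mul_card_filter (f : X → ℝ) {a b : ℝ} (ha : 0 ≤ a)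
    (hfb : ∀ x, f x ≤ b) :
    ∑ x, f x ≤ Fintype.card X * a + b * #{x | a < f x} := by
  calc ∑ x, f x ≤ ∑ x, (a + if a < f x then b else 0) := by
        refine sum_le_sum fun x _ => ?_
        split_ifs with hx
        · exact (hfb x).trans (le_add_of_nonneg_left ha)
        · linarith
    _ = Fintype.card X * a + b * #{x | a < f x} := by
        rw [sum_add_distrib, ← sum_filter, sum_const, sum_const, nsmul_eq_mul, nsmul_eq_mul,
          card_univ, mul_comm b]

theorem card_filter_add_card_filter_le (p q : Y → Prop) [DecidablePred p] [DecidablePred q] :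
    #{y | p y} + #{y | q y} ≤ Fintype.card Y + #{y | p y ∧ q y} := by
  classical
  rw [filter_and, ← card_union_add_card_inter]
  gcongr
  exact card_le_univ _

-- Two rows of density more than `a` share more than a fraction `2 * a - 1` of the columns, so all
-- dense rows with the same message are near one another.
theorem card_mul_sub_le_mul_card_image_of_oneWay [Nonempty Y] (msg : X → ι) (G : X → Y → Prop)
    [∀ x, DecidablePred (G x)] (near : X → X → Prop) [∀ x, DecidablePred (near x)] {V : ℕ}
    {a q : ℝ} (ha : 0 ≤ a)
    (hG : q * (Fintype.card X * Fintype.card Y) ≤ ∑ x, (#{y | G x y} : ℝ))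
    (hnear : ∀ x, #{x' | near x x'} ≤ V)
    (hfar : ∀ x x', msg x = msg x' → ¬ near x x' →
      (#{y | G x y ∧ G x' y} : ℝ) ≤ (2 * a - 1) * Fintype.card Y) :
    Fintype.card X * (q - a) ≤ V * #(univ.image msg) := by
  have hY : (0 : ℝ) < Fintype.card Y := by exact_mod_cast Fintype.card_pos
  set T : Finset X := {x | a * Fintype.card Y < #{y | G x y}}
  have hdense : Fintype.card X * (q - a) ≤ #T := by
    have := sum_le_card_mul_add_mul_card_filter (fun x => (#{y | G x y} : ℝ))
      (mul_nonneg ha hY.le) (b := Fintype.card Y) fun x => by exact_mod_cast card_le_univ _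
    refine le_of_mul_le_mul_left ?_ hY
    linarith
  have hfiber : ∀ x ∈ T, #{x' ∈ T | msg x' = msg x} ≤ V := by
    refine fun x hx => (card_le_card fun x' hx' => ?_).trans (hnear x)
    obtain ⟨hx', hmsg⟩ := mem_filter.1 hx'
    rw [mem_filter_univ] at hx hx' ⊢
    by_contra hxx'
    have hsum : (#{y | G x y} + #{y | G x' y} : ℝ) ≤ Fintype.card Y + #{y | G x y ∧ G x' y} := by
      exact_mod_cast card_filter_add_card_filter_le (G x) (G x')
    linarith [hfar x x' hmsg.symm hxx']
  have hT : #T ≤ V * #(T.image msg) := by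
    refine card_le_mul_card_image T V fun s hs => ?_
    obtain ⟨x, hx, rfl⟩ := mem_image.1 hs
    exact hfiber x hx
  have himage : V * #(T.image msg) ≤ V * #(univ.image msg) := by
    gcongr
    exact subset_univ T
  exact hdense.trans (by exact_mod_cast hT.trans himage)

theorem two_pow_mul_two_pow_le_of_oneWay_gapHamming {α : Type*} [Fintype α] [DecidableEq α]
    (msg : Finset α → ι) (G : Finset α → Finset α → Prop) [∀ x, DecidablePred (G x)] {s k : ℕ}
    (hk : 25 * s ^ 2 ≤ k)
    (hG : 2 / 3 * (2 ^ Fintype.card α * 2 ^ Fintype.card α) ≤ ∑ x, (#{y | G x y} : ℝ))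
    (hgap : ∀ x x' y, msg x = msg x' → G x y → G x' y →
      |(#(x ∆ y) : ℤ) - #(x' ∆ y)| < s) :
    2 ^ Fintype.card α * 2 ^ (Fintype.card α - k) ≤
      15 * 3 ^ Fintype.card α * #(univ.image msg) := by
  set N := Fintype.card α
  have hball (x : Finset α) : #{x' | #(x ∆ x') ≤ k} ≤ 3 ^ N / 2 ^ (N - k) :=
    (Nat.le_div_iff_mul_le (by positivity)).2
      (card_filter_card_symmDiff_le_mul_pow_le x k two_pos)
  have hfar (x x') (hmsg : msg x = msg x') (hxx' : ¬ #(x ∆ x') ≤ k) :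
      (#{y | G x y ∧ G x' y} : ℝ) ≤ (2 * (3 / 5) - 1) * Fintype.card (Finset α) := by
    have hcollide : 5 * #{y | G x y ∧ G x' y} ≤ 2 ^ N :=
      calc 5 * #{y | G x y ∧ G x' y}
          ≤ 5 * #{y | |(#(x ∆ y) : ℤ) - #(x' ∆ y)| < s} := by
            gcongr with y
            exact fun h => hgap x x' y hmsg h.1 h.2
        _ ≤ 2 ^ N := five_mul_card_filter_abs_card_symmDiff_sub_lt_le (by omega)
    have hcollide' : 5 * (#{y | G x y ∧ G x' y} : ℝ) ≤ 2 ^ N := by exact_mod_cast hcollide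
    rw [Fintype.card_finset, Nat.cast_pow, Nat.cast_ofNat]
    linarith
  have hcount := card_mul_sub_le_mul_card_image_of_oneWay msg G (fun x x' => #(x ∆ x') ≤ k)
    (by norm_num) (q := 2 / 3) (by simpa using hG) hball hfar
  have hmsg : 2 ^ N ≤ 15 * (3 ^ N / 2 ^ (N - k) * #(univ.image msg)) := by
    rw [Fintype.card_finset] at hcount
    push_cast [← @Nat.cast_le ℝ] at hcount ⊢
    linarith
  calc 2 ^ N * 2 ^ (N - k)
      ≤ 15 * (3 ^ N / 2 ^ (N - k) * #(univ.image msg)) * 2 ^ (N - k) := by gcongr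
    _ = 15 * (3 ^ N / 2 ^ (N - k) * 2 ^ (N - k)) * #(univ.image msg) := by ring
    _ ≤ 15 * 3 ^ N * #(univ.image msg) := by
        gcongr
        exact Nat.div_mul_le_self _ _

end OneWay

theorem card_le_sum_pow_of_length_le {β : Type*} [Fintype β] {T : Finset (List β)} {S : ℕ}
    (hT : ∀ l ∈ T, l.length ≤ S) : #T ≤ ∑ k ∈ range (S + 1), Fintype.card β ^ k := by
  classical
  have hsub : T ⊆ (range (S + 1)).biUnion fun k =>
      (univ : Finset (List.Vector β k)).image List.Vector.toList := by
    intro l hl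
    simp only [mem_biUnion, mem_range, mem_image, mem_univ, true_and]
    exact ⟨l.length, Nat.lt_succ_of_le (hT l hl), ⟨l, rfl⟩, rfl⟩
  refine (card_le_card hsub).trans (card_biUnion_le.trans (sum_le_sum fun k _ => ?_))
  exact card_image_le.trans_eq (by rw [card_univ, card_vector])

theorem card_lt_two_pow_of_length_le {T : Finset (List Bool)} {S : ℕ}
    (hT : ∀ l ∈ T, l.length ≤ S) : #T < 2 ^ (S + 1) :=
  (card_le_sum_pow_of_length_le hT).trans_lt (Nat.geomSum_lt le_rfl fun _ => mem_range.1)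

theorem exists_mul_card_le_card_filter_mem {Ω I : Type*} [Fintype I] [MeasurableSpace Ω]
    (P : Measure Ω) [IsProbabilityMeasure P] {E : I → Set Ω} [∀ ω, DecidablePred (ω ∈ E ·)]
    (hE : ∀ i, MeasurableSet (E i)) {q : ℝ} (hq : ∀ i, q ≤ P.real (E i)) :
    ∃ ω, q * Fintype.card I ≤ #{i | ω ∈ E i} := by
  have hint (i : I) : Integrable ((E i).indicator (1 : Ω → ℝ)) P :=
    (integrable_const (1 : ℝ)).indicator (hE i)
  obtain ⟨ω, hω⟩ := exists_integral_le (integrable_finsetSum univ fun i _ => hint i)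
  refine ⟨ω, ?_⟩
  calc q * Fintype.card I = ∑ _i : I, q := by simp [mul_comm]
    _ ≤ ∑ i, P.real (E i) := sum_le_sum fun i _ => hq i
    _ = ∫ ω, ∑ i, (E i).indicator (1 : Ω → ℝ) ω ∂P := by
        rw [integral_finsetSum _ fun i _ => hint i]
        exact sum_congr rfl fun i _ => (integral_indicator_one (hE i)).symm
    _ ≤ ∑ i, (E i).indicator (1 : Ω → ℝ) ω := hω
    _ = #{i | ω ∈ E i} := by simp [Set.indicator_apply]

theorem frequencyVector_eq_sum_single {n M : ℕ} (σ : List (StreamUpdate n M)) :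
    frequencyVector σ = (σ.map fun u => Pi.single u.1 (u.2 : ℕ)).sum := by
  have hfoldl (X : Fin n → ℕ) :
      σ.foldl (fun X u => Function.update X u.1 (X u.1 + (u.2 : ℕ))) X =
        X + (σ.map fun u => Pi.single u.1 (u.2 : ℕ)).sum := by
    induction σ generalizing X with
    | nil => simp
    | cons u σ ih =>
      have hupdate : Function.update X u.1 (X u.1 + (u.2 : ℕ)) = X + Pi.single u.1 (u.2 : ℕ) := by
        ext i
        obtain rfl | hi := eq_or_ne i u.1 <;> simp [*]
      rw [List.foldl_cons, ih, hupdate, List.map_cons, List.sum_cons, add_assoc]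
  rw [frequencyVector, hfoldl, zero_add]

theorem frequencyVector_append {n M : ℕ} (σ τ : List (StreamUpdate n M)) :
    frequencyVector (σ ++ τ) = frequencyVector σ + frequencyVector τ := by
  simp only [frequencyVector_eq_sum_single, List.map_append, List.sum_append]

theorem frequencyVector_replicate_zero {n M : ℕ} (ℓ : ℕ) (i : Fin n) :
    frequencyVector (List.replicate ℓ ((i, 0) : StreamUpdate n M)) = 0 := by
  simp [frequencyVector_eq_sum_single]

theorem empiricalEntropy_eq_log_sub {n : ℕ} (X : Fin n → ℕ) :
    empiricalEntropy X =
      Real.log (∑ j, (X j : ℝ)) - (∑ i, (X i : ℝ) * Real.log (X i)) / ∑ j, (X j : ℝ) := by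
  set T : ℝ := ∑ j, (X j : ℝ) with hT
  have hterm (i : Fin n) :
      (X i : ℝ) / T * Real.log (T / X i) = X i * (Real.log T / T) - X i * Real.log (X i) / T := by
    obtain hi | hi := (X i).eq_zero_or_pos
    · simp [hi]
    · have hXi : (0 : ℝ) < X i := by exact_mod_cast hi
      have hTpos : 0 < T :=
        hXi.trans_le (single_le_sum (fun j _ => Nat.cast_nonneg (X j)) (mem_univ i))
      rw [Real.log_div hTpos.ne' hXi.ne']
      ring
  have hlog : T * (Real.log T / T) = Real.log T := by
    obtain h0 | h0 := eq_or_ne T 0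
    · simp [h0]
    · exact mul_div_cancel₀ _ h0
  rw [empiricalEntropy, ← hT, sum_congr rfl fun i _ => hterm i, sum_sub_distrib, ← sum_mul, ← hT,
    hlog, sum_div]

theorem measurableSet_setOf_of_countable {Ω β : Type*} [MeasurableSpace Ω] [Countable β]
    {f : Ω → β} {p : β → Ω → Prop} (hf : ∀ b, MeasurableSet {ω | f ω = b})
    (hp : ∀ b, MeasurableSet {ω | p b ω}) : MeasurableSet {ω | p (f ω) ω} := by
  have hunion : {ω | p (f ω) ω} = ⋃ b, {ω | f ω = b} ∩ {ω | p b ω} := by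
    ext ω
    simp
  rw [hunion]
  exact MeasurableSet.iUnion fun b => (hf b).inter (hp b)

namespace StreamingAlgorithm

variable {n M : ℕ} {Ω : Type*} [MeasurableSpace Ω]

theorem runFrom_append (A : StreamingAlgorithm n M Ω) (ω : Ω) (k : ℕ) (s : List Bool)
    (σ τ : List (StreamUpdate n M)) :
    A.runFrom ω k s (σ ++ τ) = A.runFrom ω (k + σ.length) (A.runFrom ω k s σ) τ := by
  induction σ generalizing k s with
  | nil => rfl
  | cons u σ ih =>
    simp only [List.cons_append, runFrom, ih, List.length_cons, add_assoc, add_comm 1]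

theorem run_append_congr (A : StreamingAlgorithm n M Ω) {ω : Ω} {σ σ' : List (StreamUpdate n M)}
    (hlength : σ.length = σ'.length) (hrun : A.run ω σ = A.run ω σ')
    (τ : List (StreamUpdate n M)) : A.run ω (σ ++ τ) = A.run ω (σ' ++ τ) := by
  unfold run at hrun ⊢
  rw [runFrom_append, runFrom_append, hrun, hlength]

theorem card_image_run_lt {X : Type*} [Fintype X] (A : StreamingAlgorithm n M Ω) (ω : Ω)
    {m S : ℕ} (hS : A.UsesSpaceAtMost m S) {σ : X → List (StreamUpdate n M)}
    (hσ : ∀ x, (σ x).length ≤ m) : #(univ.image fun x => A.run ω (σ x)) < 2 ^ (S + 1) :=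
  card_lt_two_pow_of_length_le <| by simpa using fun x => hS ω (σ x) (hσ x)

theorem measurableSet_runFrom_eq (A : StreamingAlgorithm n M Ω) (k : ℕ) (s : List Bool)
    (σ : List (StreamUpdate n M)) (s' : List Bool) :
    MeasurableSet {ω | A.runFrom ω k s σ = s'} := by
  induction σ generalizing k s with
  | nil => exact MeasurableSet.const (s = s')
  | cons u σ ih =>
    exact measurableSet_setOf_of_countable (A.measurableSet_step k u s) (ih (k + 1))

theorem measurableSet_run_eq (A : StreamingAlgorithm n M Ω) (σ : List (StreamUpdate n M))
    (s : List Bool) : MeasurableSet {ω | A.run ω σ = s} :=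
  measurableSet_setOf_of_countable A.measurableSet_init fun t =>
    A.measurableSet_runFrom_eq 0 t σ s

theorem measurableSet_abs_output_sub_le (A : StreamingAlgorithm n M Ω)
    (σ : List (StreamUpdate n M)) (h ε : ℝ) :
    MeasurableSet {ω | |A.output ω (A.run ω σ) - h| ≤ ε} :=
  measurableSet_setOf_of_countable (A.measurableSet_run_eq σ) fun s =>
    measurableSet_le ((A.measurable_output s).sub_const h).abs measurable_const

end StreamingAlgorithm

section Encoding

variable {α : Type*} [Fintype α] [DecidableEq α] {n M : ℕ}

/-- The unit-increment stream that encodes a subset `x` of `α`: for each `k : α` it increments the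
coordinate `e (k, true)` if `k ∈ x`, and `e (k, false)` if `k ∉ x`. -/
noncomputable def encodingStream (e : α × Bool ↪ Fin n) (x : Finset α) :
    List (StreamUpdate n M) :=
  (univ : Finset α).toList.map fun k => (e (k, decide (k ∈ x)), 1)

theorem length_encodingStream (e : α × Bool ↪ Fin n) (x : Finset α) :
    (encodingStream (M := M) e x).length = Fintype.card α := by
  simp [encodingStream]

theorem frequencyVector_encodingStream (hM : 1 ≤ M) (e : α × Bool ↪ Fin n) (x : Finset α) :
    frequencyVector (encodingStream (M := M) e x) =
      ∑ k, Pi.single (e (k, decide (k ∈ x))) 1 := by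
  have hone : ((1 : Fin (M + 1)) : ℕ) = 1 := by
    rw [Fin.val_one', Nat.mod_eq_of_lt (Nat.succ_lt_succ hM)]
  rw [frequencyVector_eq_sum_single, encodingStream, List.map_map, ← sum_map_toList]
  simp only [Function.comp_def, hone]

theorem frequencyVector_encodingStream_apply (hM : 1 ≤ M) (e : α × Bool ↪ Fin n) (x : Finset α)
    (k : α) (b : Bool) :
    frequencyVector (encodingStream (M := M) e x) (e (k, b)) =
      if decide (k ∈ x) = b then 1 else 0 := by
  rw [frequencyVector_encodingStream hM, Finset.sum_apply, sum_eq_single k]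
  · simp [Pi.single_apply, eq_comm]
  · intro l _ hl
    simp [hl.symm]
  · simp

theorem frequencyVector_encodingStream_of_notMem_range (hM : 1 ≤ M) (e : α × Bool ↪ Fin n)
    (x : Finset α) {i : Fin n} (hi : i ∉ Set.range e) :
    frequencyVector (encodingStream (M := M) e x) i = 0 := by
  rw [frequencyVector_encodingStream hM, Finset.sum_apply]
  refine sum_eq_zero fun k _ => Pi.single_eq_of_ne ?_ _
  rintro rfl
  exact hi (Set.mem_range_self _)

theorem sum_comp_frequencyVector_add (hM : 1 ≤ M) (e : α × Bool ↪ Fin n) (x y : Finset α)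
    {f : ℕ → ℝ} (hf : f 0 = 0) :
    ∑ i, f ((frequencyVector (encodingStream (M := M) e x) +
      frequencyVector (encodingStream (M := M) e y)) i) =
      #(x ∆ y) * (2 * f 1) + (Fintype.card α - #(x ∆ y)) * f 2 := by
  set X : Fin n → ℕ := frequencyVector (encodingStream (M := M) e x) +
    frequencyVector (encodingStream (M := M) e y)
  have hrange : ∑ i, f (X i) = ∑ k, (f (X (e (k, true))) + f (X (e (k, false)))) := by
    rw [← Fintype.sum_of_injective e e.injective (fun kb => f (X (e kb))) (fun i => f (X i))
      (fun i hi => ?_) fun _ => rfl, Fintype.sum_prod_type]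
    · simp only [Fintype.sum_bool]
    · simp [X, frequencyVector_encodingStream_of_notMem_range hM e _ hi, hf]
  have hpair (k : α) : f (X (e (k, true))) + f (X (e (k, false))) =
      if k ∈ x ∆ y then 2 * f 1 else f 2 := by
    simp only [X, Pi.add_apply, frequencyVector_encodingStream_apply hM, mem_symmDiff]
    by_cases hx : k ∈ x <;> by_cases hy : k ∈ y <;> simp [hx, hy, hf, two_mul]
  rw [hrange, sum_congr rfl fun k _ => hpair k, sum_ite, sum_const, sum_const, filter_mem_eq_inter,
    univ_inter, filter_not, filter_mem_eq_inter, univ_inter, ← compl_eq_univ_sdiff, card_compl,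
    nsmul_eq_mul, nsmul_eq_mul, Nat.cast_sub (card_le_univ _)]

/-- The stream of the reduction from the one-way communication game in which Alice holds `x` and
Bob holds `y`: the encoding of `x`, followed by that of `y` and by zero updates of the coordinate
`i₀` that pad it to `m` updates. The length is `m` only if `2 * Fintype.card α ≤ m`, since the
number of zero updates is a truncated difference. -/
noncomputable def gapHammingStream (e : α × Bool ↪ Fin n) (i₀ : Fin n) (m : ℕ)
    (x y : Finset α) : List (StreamUpdate n M) :=
  encodingStream e x ++ (encodingStream e y ++ List.replicate (m - 2 * Fintype.card α) (i₀, 0))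

theorem length_gapHammingStream (e : α × Bool ↪ Fin n) (i₀ : Fin n) {m : ℕ}
    (hm : 2 * Fintype.card α ≤ m) (x y : Finset α) :
    (gapHammingStream (M := M) e i₀ m x y).length = m := by
  simp only [gapHammingStream, List.length_append, length_encodingStream, List.length_replicate]
  omega

theorem frequencyVector_gapHammingStream (e : α × Bool ↪ Fin n) (i₀ : Fin n) (m : ℕ)
    (x y : Finset α) :
    frequencyVector (gapHammingStream (M := M) e i₀ m x y) =
      frequencyVector (encodingStream (M := M) e x) +
        frequencyVector (encodingStream (M := M) e y) := by
  rw [gapHammingStream, frequencyVector_append, frequencyVector_append,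
    frequencyVector_replicate_zero, add_zero]

theorem sum_frequencyVector_gapHammingStream (hM : 1 ≤ M) (e : α × Bool ↪ Fin n) (i₀ : Fin n)
    (m : ℕ) (x y : Finset α) :
    ∑ i, (frequencyVector (gapHammingStream (M := M) e i₀ m x y) i : ℝ) =
      2 * Fintype.card α := by
  rw [frequencyVector_gapHammingStream, sum_comp_frequencyVector_add hM e x y Nat.cast_zero]
  push_cast
  ring

theorem frequencyVector_gapHammingStream_ne_zero [Nonempty α] (hM : 1 ≤ M) (e : α × Bool ↪ Fin n)
    (i₀ : Fin n) (m : ℕ) (x y : Finset α) :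
    frequencyVector (gapHammingStream (M := M) e i₀ m x y) ≠ 0 := by
  intro h
  have hsum := sum_frequencyVector_gapHammingStream hM e i₀ m x y
  simp [h] at hsum

theorem empiricalEntropy_gapHammingStream [Nonempty α] (hM : 1 ≤ M) (e : α × Bool ↪ Fin n)
    (i₀ : Fin n) (m : ℕ) (x y : Finset α) :
    empiricalEntropy (frequencyVector (gapHammingStream (M := M) e i₀ m x y)) =
      Real.log (Fintype.card α) + #(x ∆ y) * Real.log 2 / Fintype.card α := by
  have hN : (Fintype.card α : ℝ) ≠ 0 := by exact_mod_cast Fintype.card_ne_zero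
  rw [empiricalEntropy_eq_log_sub, sum_frequencyVector_gapHammingStream hM,
    frequencyVector_gapHammingStream,
    sum_comp_frequencyVector_add hM e x y (f := fun v => v * Real.log v) (by simp),
    Real.log_mul two_ne_zero hN]
  push_cast
  rw [Real.log_one]
  field_simp
  ring

theorem abs_card_symmDiff_sub_lt_of_abs_sub_empiricalEntropy_le [Nonempty α] (hM : 1 ≤ M)
    (e : α × Bool ↪ Fin n) (i₀ : Fin n) (m : ℕ) {x x' y : Finset α} {s : ℕ} {ε h : ℝ}
    (hε : 2 * ε * Fintype.card α < s * Real.log 2)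
    (hx : |h - empiricalEntropy (frequencyVector (gapHammingStream (M := M) e i₀ m x y))| ≤ ε)
    (hx' : |h - empiricalEntropy (frequencyVector (gapHammingStream (M := M) e i₀ m x' y))| ≤ ε) :
    |(#(x ∆ y) : ℤ) - #(x' ∆ y)| < s := by
  have hN : (0 : ℝ) < Fintype.card α := by exact_mod_cast Fintype.card_pos
  have hlog : 0 < Real.log 2 := Real.log_pos one_lt_two
  have hentropy : |(#(x ∆ y) - #(x' ∆ y) : ℝ) * (Real.log 2 / Fintype.card α)| ≤ 2 * ε := by
    rw [empiricalEntropy_gapHammingStream hM, abs_le] at hx hx'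
    rw [sub_mul, mul_div_assoc', mul_div_assoc', abs_le]
    constructor <;> linarith
  have hdist : |(#(x ∆ y) - #(x' ∆ y) : ℝ)| * Real.log 2 ≤ 2 * ε * Fintype.card α := by
    rwa [abs_mul, abs_of_pos (div_pos hlog hN), mul_div_assoc', div_le_iff₀ hN] at hentropy
  exact_mod_cast lt_of_mul_lt_mul_right (hdist.trans_lt hε) hlog.le

end Encoding

theorem StreamingAlgorithm.two_pow_mul_two_pow_le_of_approximatesEntropy {α : Type*} [Fintype α]
    [Nonempty α] {n m M S s k : ℕ} {ε : ℝ} {Ω : Type*} [MeasurableSpace Ω] {P : Measure Ω}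
    [IsProbabilityMeasure P] {A : StreamingAlgorithm n M Ω} (e : α × Bool ↪ Fin n) (hM : 1 ≤ M)
    (hm : 2 * Fintype.card α ≤ m) (hε : 2 * ε * Fintype.card α < s * Real.log 2)
    (hk : 25 * s ^ 2 ≤ k) (hA : A.ApproximatesEntropy P m ε (2 / 3))
    (hS : A.UsesSpaceAtMost m S) :
    2 ^ Fintype.card α * 2 ^ (Fintype.card α - k) ≤ 15 * 3 ^ Fintype.card α * 2 ^ (S + 1) := by
  classical
  set σ : Finset α → Finset α → List (StreamUpdate n M) :=
    gapHammingStream e (e (Classical.arbitrary α, true)) m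
  set E : Finset α × Finset α → Set Ω := fun p =>
    {ω | |A.output ω (A.run ω (σ p.1 p.2)) - empiricalEntropy (frequencyVector (σ p.1 p.2))| ≤ ε}
  obtain ⟨ω, hω⟩ := exists_mul_card_le_card_filter_mem P (E := E)
    (fun p => A.measurableSet_abs_output_sub_le _ _ _) fun p =>
      hA (σ p.1 p.2) (length_gapHammingStream e _ hm _ _)
        (frequencyVector_gapHammingStream_ne_zero hM e _ m _ _)
  have hcorrect : 2 / 3 * (2 ^ Fintype.card α * 2 ^ Fintype.card α) ≤
      ∑ x, (#{y | ω ∈ E (x, y)} : ℝ) := by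
    rw [card_filter, Fintype.sum_prod_type, Fintype.card_prod, Fintype.card_finset] at hω
    simp only [card_filter]
    exact_mod_cast hω
  have hgap (x x' y : Finset α)
      (hxx' : A.run ω (encodingStream e x) = A.run ω (encodingStream e x'))
      (hx : ω ∈ E (x, y)) (hx' : ω ∈ E (x', y)) : |(#(x ∆ y) : ℤ) - #(x' ∆ y)| < s := by
    have hrun : A.run ω (σ x y) = A.run ω (σ x' y) :=
      A.run_append_congr (by simp only [length_encodingStream]) hxx' _
    refine abs_card_symmDiff_sub_lt_of_abs_sub_empiricalEntropy_le hM e _ m hε hx ?_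
    rw [hrun]
    exact hx'
  refine (two_pow_mul_two_pow_le_of_oneWay_gapHamming _ (fun x y => ω ∈ E (x, y)) hk hcorrect
    hgap).trans ?_
  gcongr
  refine (A.card_image_run_lt ω hS fun x => ?_).le
  rw [length_encodingStream]
  omega

theorem le_of_two_pow_mul_two_pow_le {k S : ℕ} (hk : 2 ≤ k)
    (h : 2 ^ (10 * k) * 2 ^ (10 * k - k) ≤ 15 * 3 ^ (10 * k) * 2 ^ (S + 1)) : k ≤ S := by
  have hpow : 2 ^ (19 * k) < 2 ^ (16 * k + S + 5) :=
    calc 2 ^ (19 * k) = 2 ^ (10 * k) * 2 ^ (10 * k - k) := by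
          rw [← pow_add]
          congr 1
          omega
      _ ≤ 15 * (3 ^ 10) ^ k * 2 ^ (S + 1) := by rwa [← pow_mul]
      _ < 2 ^ 4 * (2 ^ 16) ^ k * 2 ^ (S + 1) := by
          gcongr ?_ * ?_
          exact Nat.mul_lt_mul_of_lt_of_le (by norm_num)
            (Nat.pow_le_pow_left (by norm_num) k) (by positivity)
      _ = 2 ^ (16 * k + S + 5) := by rw [← pow_mul]; ring
  have := (Nat.pow_lt_pow_iff_right one_lt_two).1 hpow
  omega

theorem StreamingAlgorithm.mul_sq_le_space_of_approximatesEntropy {n m M S s : ℕ} {ε : ℝ}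
    {Ω : Type*} [MeasurableSpace Ω] {P : Measure Ω} [IsProbabilityMeasure P]
    {A : StreamingAlgorithm n M Ω} (hM : 1 ≤ M) (hn : 500 * s ^ 2 ≤ n)
    (hm : 500 * s ^ 2 ≤ m) (hε : ε * s ≤ 1 / 1000) (hA : A.ApproximatesEntropy P m ε (2 / 3))
    (hS : A.UsesSpaceAtMost m S) : 25 * s ^ 2 ≤ S := by
  obtain rfl | hs := s.eq_zero_or_pos
  · simp
  have hk : 0 < 25 * s ^ 2 := by positivity
  have : NeZero (10 * (25 * s ^ 2)) := ⟨by positivity⟩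
  obtain ⟨e⟩ : Nonempty (Fin (10 * (25 * s ^ 2)) × Bool ↪ Fin n) :=
    Function.Embedding.nonempty_of_card_le (by
      simp only [Fintype.card_prod, Fintype.card_fin, Fintype.card_bool]; omega)
  have hsep : 2 * ε * (10 * (25 * s ^ 2) : ℕ) < s * Real.log 2 := by
    have hs' : (0 : ℝ) < s := by exact_mod_cast hs
    calc 2 * ε * (10 * (25 * s ^ 2) : ℕ) = s * (500 * (ε * s)) := by push_cast; ring
      _ < s * Real.log 2 :=
          mul_lt_mul_of_pos_left (by linarith [Real.log_two_gt_d9]) hs'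
  refine le_of_two_pow_mul_two_pow_le (by omega) ?_
  simpa only [Fintype.card_fin] using two_pow_mul_two_pow_le_of_approximatesEntropy e hM
    (by rw [Fintype.card_fin]; omega) (by rwa [Fintype.card_fin]) le_rfl hA hS

theorem exists_nat_mul_mem_Icc {a b : ℝ} (ha : 0 < a) (hab : a ≤ b) :
    ∃ s : ℕ, a * s ∈ Set.Icc (b / 2) b := by
  have hone : 1 ≤ b / a := (one_le_div ha).2 hab
  have hfloor : (1 : ℝ) ≤ ⌊b / a⌋₊ := by exact_mod_cast Nat.floor_pos.2 hone
  have hle : a * ⌊b / a⌋₊ ≤ b := (le_div_iff₀' ha).1 (Nat.floor_le (by linarith))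
  have hlt : b < a * (⌊b / a⌋₊ + 1) := (div_lt_iff₀' ha).1 (Nat.lt_floor_add_one _)
  exact ⟨⌊b / a⌋₊, by nlinarith, hle⟩

theorem mainTheorem12 :
    ∃ c : ℝ, 0 < c ∧ ∃ ε₀ : ℝ, 0 < ε₀ ∧
      ∀ ε : ℝ, 0 < ε → ε < ε₀ →
      ∀ n m M : ℕ, 1 / ε ^ 2 ≤ (n : ℝ) → 1 / ε ^ 2 ≤ (m : ℝ) → 1 ≤ M →
      ∀ (Ω : Type*) [MeasurableSpace Ω] (P : MeasureTheory.Measure Ω)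
        [MeasureTheory.IsProbabilityMeasure P] (A : StreamingAlgorithm n M Ω),
        A.ApproximatesEntropy P m ε (2 / 3) →
        ∀ S : ℕ, A.UsesSpaceAtMost m S → c / ε ^ 2 ≤ (S : ℝ) := by
  refine ⟨1 / 160000, by norm_num, 1 / 1000, by norm_num, ?_⟩
  intro ε hε hε₀ n m M hn hm hM Ω _ P _ A hA S hS
  obtain ⟨s, hle, hge⟩ := exists_nat_mul_mem_Icc hε hε₀.le
  have hsize : ((500 * s ^ 2 : ℕ) : ℝ) ≤ 1 / ε ^ 2 := by
    rw [le_div_iff₀ (by positivity)]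
    push_cast
    nlinarith
  have hspace : 25 * s ^ 2 ≤ S := A.mul_sq_le_space_of_approximatesEntropy hM
    (by exact_mod_cast hsize.trans hn) (by exact_mod_cast hsize.trans hm) hge hA hS
  calc 1 / 160000 / ε ^ 2 ≤ (25 * s ^ 2 : ℕ) := by
        rw [div_le_iff₀ (by positivity)]
        push_cast
        nlinarith
    _ ≤ S := by exact_mod_cast hspace
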